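/- A \emph{Wajsberg hoop} is an algebra $(A,\cdot,\to,1)$ such that $(A,\cdot,1)$ is a commutative monoid and, for all $x,y,z\in A$: $x\to x=1$; $x\cdot(x\to y)=y\cdot(y\to x)$; $(x\cdot y)\to z=x\to(y\to z)$; and $(x\to y)\to y=(y\to x)\to x$. It is ordered by $x\le y$ if and only if $x\to y=1$; it is \emph{bounded} if it has a least element in this order, and \emph{unbounded} otherwise. It is \emph{finitely generated} if it is generated by a finite subset as an algebra in this signature. A Wajsberg hoop $A$ is \emph{projective} if for every surjective homomorphism $g\colon B\to C$ of Wajsberg hoops and every homomorphism $f\colon A\to C$ there is a homomorphism $h\colon A\to B$ with $g\circ h=f$. It is \emph{weakly projective} if, whenever $A$ is a homomorphic image of a Wajsberg hoop $B$, $A$ is isomorphic to a subalgebra of $B$. The \emph{$0$-free reduct} of an MV-algebra $(M,\oplus,\neg,0)$ is the Wajsberg hoop on $M$ with $1=\neg 0$, $x\cdot y=\neg(\neg x\oplus\neg y)$ and $x\to y=\neg x\oplus y$. (1) Every finitely generated weakly projective Wajsberg hoop with more than one element is unbounded. (2) Every finitely generated projective Wajsberg hoop with more than one element is unbounded. (3)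 If $M$ is an MV-algebra with more than one element whose $0$-free reduct is finitely generated, then this $0$-free reduct is not projective in the variety of Wajsberg hoops. -/

import Mathlib

universe u

/-- A Wajsberg hoop: a hoop `(A, *, ⇨, 1)` satisfying Tanaka's equation. The lattice operations are
terms: `x ∧ y = x * (x ⇨ y)` and `x ∨ y = (x ⇨ y) ⇨ y`, and `x ≤ y` means `x ⇨ y = 1`. -/
class WajsbergHoop (A : Type u) extends CommMonoid A, HImp A where
  himp_self (x : A) : x ⇨ x = 1
  mul_himp_comm (x y : A) : x * (x ⇨ y) = y * (y ⇨ x)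
  mul_himp (x y z : A) : (x * y) ⇨ z = x ⇨ (y ⇨ z)
  tanaka (x y : A) : (x ⇨ y) ⇨ y = (y ⇨ x) ⇨ x

namespace WajsbergHoop

/-- Homomorphisms of Wajsberg hoops. -/
structure Hom (A B : Type u) [WajsbergHoop A] [WajsbergHoop B] where
  toFun : A → B
  map_one : toFun 1 = 1
  map_mul (x y : A) : toFun (x * y) = toFun x * toFun y
  map_himp (x y : A) : toFun (x ⇨ y) = toFun x ⇨ toFun y

instance (A B : Type u) [WajsbergHoop A] [WajsbergHoop B] : CoeFun (Hom A B) (fun _ => A → B) where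
  coe := Hom.toFun

/-- Subalgebras of a Wajsberg hoop. -/
structure Subhoop (A : Type u) [WajsbergHoop A] where
  carrier : Set A
  one_mem : 1 ∈ carrier
  mul_mem {x y : A} : x ∈ carrier → y ∈ carrier → x * y ∈ carrier
  himp_mem {x y : A} : x ∈ carrier → y ∈ carrier → x ⇨ y ∈ carrier

/-- The elements of a subalgebra, as a type. -/
def Subhoop.Elem {A : Type u} [WajsbergHoop A] (S : Subhoop A) : Type u :=
  {x : A // x ∈ S.carrier}

/-- A subalgebra is a Wajsberg hoop with the restricted operations. -/
instance (A : Type u) [WajsbergHoop A] (S : Subhoop A) : WajsbergHoop S.Elem where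
  mul x y := ⟨x.1 * y.1, S.mul_mem x.2 y.2⟩
  one := ⟨1, S.one_mem⟩
  himp x y := ⟨x.1 ⇨ y.1, S.himp_mem x.2 y.2⟩
  mul_assoc x y z := Subtype.ext (mul_assoc x.1 y.1 z.1)
  one_mul x := Subtype.ext (one_mul x.1)
  mul_one x := Subtype.ext (mul_one x.1)
  mul_comm x y := Subtype.ext (mul_comm x.1 y.1)
  himp_self x := Subtype.ext (himp_self x.1)
  mul_himp_comm x y := Subtype.ext (mul_himp_comm x.1 y.1)
  mul_himp x y z := Subtype.ext (mul_himp x.1 y.1 z.1)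
  tanaka x y := Subtype.ext (tanaka x.1 y.1)

/-- `A` and `B` are isomorphic. -/
def Isomorphic (A B : Type u) [WajsbergHoop A] [WajsbergHoop B] : Prop :=
  ∃ f : Hom A B, Function.Bijective f

/-- `A` is generated by a finite set: some finite subset lies in no proper subalgebra. -/
def FinitelyGenerated (A : Type u) [WajsbergHoop A] : Prop :=
  ∃ X : Set A, X.Finite ∧ ∀ S : Subhoop A, X ⊆ S.carrier → S.carrier = Set.univ

/-- `A` has a least element with respect to the natural order (`x ≤ y` iff `x ⇨ y = 1`). -/
def Bounded (A : Type u) [WajsbergHoop A] : Prop :=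
  ∃ b : A, ∀ x : A, b ⇨ x = 1

/-- `A` is unbounded: it has no least element. -/
def Unbounded (A : Type u) [WajsbergHoop A] : Prop :=
  ¬ Bounded A

/-- `A` is projective in the variety of Wajsberg hoops: homomorphisms from `A` lift along surjective
homomorphisms. -/
def Projective (A : Type u) [WajsbergHoop A] : Prop :=
  ∀ (B C : Type u) [WajsbergHoop B] [WajsbergHoop C] (g : Hom B C) (f : Hom A C),
    Function.Surjective g → ∃ h : Hom A B, ∀ a : A, g (h a) = f a

/-- `A` is weakly projective: whenever `A` is a homomorphic image of a Wajsberg hoop `B`, it is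
isomorphic to a subalgebra of `B`. -/
def WeaklyProjective (A : Type u) [WajsbergHoop A] : Prop :=
  ∀ (B : Type u) [WajsbergHoop B],
    (∃ g : Hom B A, Function.Surjective g) → ∃ S : Subhoop B, Isomorphic A S.Elem

end WajsbergHoop

/-- An MV-algebra `(A, ⊕, ¬, 0)`, with `⊕` written `+` and `¬` written `ᶜ`. -/
class MVAlgebra (A : Type u) extends AddCommMonoid A, Compl A where
  compl_compl (x : A) : xᶜᶜ = x
  add_compl_zero (x : A) : x + 0ᶜ = 0ᶜ
  lukasiewicz (x y : A) : (xᶜ + y)ᶜ + y = (yᶜ + x)ᶜ + x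

namespace MVAlgebra

/-- The carrier of the `0`-free reduct of an MV-algebra. -/
def ZeroFreeReduct (A : Type u) : Type u := A

/-- The `0`-free reduct of an MV-algebra, with `1 = ¬0`, `x * y = ¬(¬x ⊕ ¬y)` and
`x ⇨ y = ¬x ⊕ y`. -/
instance (A : Type u) [MVAlgebra A] : WajsbergHoop (ZeroFreeReduct A) where
  mul (x y : A) := ((xᶜ + yᶜ)ᶜ : A)
  one := (0ᶜ : A)
  himp (x y : A) := (xᶜ + y : A)
  mul_assoc (x y z : A) := by
    change ((xᶜ + yᶜ)ᶜᶜ + zᶜ)ᶜ = (xᶜ + (yᶜ + zᶜ)ᶜᶜ)ᶜ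
    rw [compl_compl, compl_compl, add_assoc]
  one_mul (x : A) := by
    change (0ᶜᶜ + xᶜ)ᶜ = x
    rw [compl_compl, zero_add, compl_compl]
  mul_one (x : A) := by
    change (xᶜ + 0ᶜᶜ)ᶜ = x
    rw [compl_compl, add_zero, compl_compl]
  mul_comm (x y : A) := by
    change (xᶜ + yᶜ)ᶜ = (yᶜ + xᶜ)ᶜ
    rw [add_comm]
  himp_self (x : A) := by
    change xᶜ + x = 0ᶜ
    have h := lukasiewicz x (0ᶜ)
    rw [add_compl_zero, compl_compl, zero_add] at h
    exact h.symm
  mul_himp_comm (x y : A) := by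
    change (xᶜ + (xᶜ + y)ᶜ)ᶜ = (yᶜ + (yᶜ + x)ᶜ)ᶜ
    have h := lukasiewicz (yᶜ) (xᶜ)
    rw [compl_compl, compl_compl, add_comm y, add_comm x] at h
    rw [add_comm (xᶜ) ((xᶜ + y)ᶜ), h, add_comm]
  mul_himp (x y z : A) := by
    change (xᶜ + yᶜ)ᶜᶜ + z = xᶜ + (yᶜ + z)
    rw [compl_compl, add_assoc]
  tanaka (x y : A) := lukasiewicz x y

end MVAlgebra

/-!
A bounded Wajsberg hoop `A` with more than one element is never weakly projective. A least element
of a hoop is idempotent, so it suffices to present `A` as an image of a hoop `B` whose only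
idempotent is `1`: an embedding of `A` into `B` would send the least element to `1`.

Such a hoop is `pathHoop A`. Its elements are pairs of an element `a` of `A` and a family of
continuous paths, one from `φ a` to `1` for every homomorphism `φ` from `A` to the standard hoop on
`[0, 1]`. It projects onto `A` (`pathProj_surjective`). The idempotents of `[0, 1]` are `0` and `1`,
so by connectedness the paths of an idempotent are constantly `1` (`eq_one_of_idempotent_path`),
whence `φ a = 1` for all `φ`.

It remains to separate an idempotent `a ≠ 1` of `A` from `1` by some `φ`
(`exists_standardHom_ne_one`). The quotient of `A` by a filter maximal among those avoiding `a` is a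
bounded chain in which `a` becomes the least element, so a homomorphism from a bounded chain to
`[0, 1]` with least element sent to `0` is enough. It is given by `realValue`, which sends `x` to
the real number whose binary digits are read off the orbit of `x` under the doubling map
`x ↦ 2 * x - digit x`. Additivity is proved for triples with sum exactly `1`
(`SumOne.realValue_add`): doubling turns such a triple into another one (up to complements) and the
bounded error of `realValue` on it is halved each time, so it is zero.

A section of a surjection is injective, so projectivity is excluded in the same way, and the
`0`-free reduct of an MV-algebra has the least element `0`.
-/

namespace WajsbergHoop

/-! ### Arithmetic of Wajsberg hoops -/

section Order

variable {A : Type u} [WajsbergHoop A]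

theorem one_himp_and_himp_one (x : A) : (1 : A) ⇨ x = x ∧ x ⇨ (1 : A) = 1 := by
  have h1 : (1 : A) ⇨ x = x * (x ⇨ 1) := by
    have := mul_himp_comm 1 x
    rwa [one_mul] at this
  have h2 : x ⇨ ((1 : A) ⇨ x) = 1 := by rw [← mul_himp, mul_one, himp_self]
  have h3 : ((1 : A) ⇨ x) * (((1 : A) ⇨ x) ⇨ x) = x := by
    rw [mul_himp_comm, h2, mul_one]
  have h4 : ((1 : A) ⇨ x) ⇨ x = (x ⇨ 1) ⇨ 1 := by
    rw [h1, mul_comm, mul_himp, himp_self]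
  have h5 : (1 : A) ⇨ (x ⇨ 1) = x ⇨ 1 := by rw [← mul_himp, one_mul]
  have h6 : (x ⇨ 1) * ((x ⇨ 1) ⇨ 1) = x ⇨ (1 : A) := by
    rw [mul_himp_comm, one_mul, h5]
  have h7 : x * (x ⇨ 1) = x := by
    rw [h4, h1, mul_assoc, h6] at h3
    exact h3
  refine ⟨h1.trans h7, ?_⟩
  calc x ⇨ (1 : A) = (x * (x ⇨ 1)) ⇨ 1 := by rw [h7]
    _ = 1 := by rw [mul_comm, mul_himp, himp_self]

@[simp]
theorem one_himp (x : A) : (1 : A) ⇨ x = x := (one_himp_and_himp_one x).1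

@[simp]
theorem himp_one (x : A) : x ⇨ (1 : A) = 1 := (one_himp_and_himp_one x).2

/-- The natural order of a Wajsberg hoop. It is only a local instance, since `A` may come with an
order of its own. -/
@[reducible]
def naturalOrder (A : Type u) [WajsbergHoop A] : PartialOrder A where
  le x y := x ⇨ y = 1
  le_refl := himp_self
  le_trans x y _ hxy hyz := by
    have hx : x = (y ⇨ x) * y := by
      have := mul_himp_comm x y
      rwa [hxy, mul_one, mul_comm] at this
    rw [hx, mul_himp, hyz, himp_one]
  le_antisymm x y hxy hyx := by
    have := mul_himp_comm x y
    rwa [hxy, hyx, mul_one, mul_one] at this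

attribute [local instance] naturalOrder

theorem le_iff {x y : A} : x ≤ y ↔ x ⇨ y = 1 := Iff.rfl

theorem mul_le_iff_le_himp {x y w : A} : x * y ≤ w ↔ x ≤ y ⇨ w := by
  rw [le_iff, le_iff, mul_himp]

theorem naturalOrder_isOrderedMonoid (A : Type u) [WajsbergHoop A] : IsOrderedMonoid A where
  mul_le_mul_left _ _ h _ :=
    mul_le_iff_le_himp.2 (h.trans (mul_le_iff_le_himp.1 le_rfl))

attribute [local instance] naturalOrder_isOrderedMonoid

theorem le_one (x : A) : x ≤ 1 := himp_one x

theorem eq_one_of_one_le {x : A} (h : 1 ≤ x) : x = 1 := le_antisymm (le_one x) h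

theorem mul_le_left (x y : A) : x * y ≤ x := by
  simpa using mul_le_mul_right (le_one y) x

theorem mul_le_right (x y : A) : x * y ≤ y := by
  rw [mul_comm]; exact mul_le_left y x

theorem himp_mul_le (x y : A) : (x ⇨ y) * x ≤ y := mul_le_iff_le_himp.2 le_rfl

theorem mul_himp_le (x y : A) : x * (x ⇨ y) ≤ y := by
  rw [mul_comm]; exact himp_mul_le x y

theorem le_himp (x y : A) : y ≤ x ⇨ y := mul_le_iff_le_himp.1 (mul_le_left y x)

theorem mul_himp_of_le {x y : A} (h : x ≤ y) : y * (y ⇨ x) = x := by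
  rw [mul_himp_comm, le_iff.1 h, mul_one]

theorem himp_himp_of_le {x y : A} (h : x ≤ y) : (y ⇨ x) ⇨ x = y := by
  rw [tanaka, le_iff.1 h, one_himp]

theorem himp_le_himp_right {x y : A} (h : x ≤ y) (w : A) : y ⇨ w ≤ x ⇨ w :=
  mul_le_iff_le_himp.1 ((mul_le_mul_right h _).trans (himp_mul_le y w))

theorem mul_himp_le_himp_mul (x x' y y' : A) :
    (x ⇨ x') * (y ⇨ y') ≤ (x * y) ⇨ (x' * y') := by
  rw [← mul_le_iff_le_himp, mul_mul_mul_comm]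
  exact mul_le_mul' (himp_mul_le x x') (himp_mul_le y y')

theorem mul_himp_le_himp_himp (x x' y y' : A) :
    (x' ⇨ x) * (y ⇨ y') ≤ (x ⇨ y) ⇨ (x' ⇨ y') := by
  rw [← mul_le_iff_le_himp, ← mul_le_iff_le_himp]
  calc (x' ⇨ x) * (y ⇨ y') * (x ⇨ y) * x'
      = (y ⇨ y') * ((x ⇨ y) * ((x' ⇨ x) * x')) := by ac_rfl
    _ ≤ (y ⇨ y') * ((x ⇨ y) * x) := by gcongr; exact himp_mul_le x' x
    _ ≤ (y ⇨ y') * y := by gcongr; exact himp_mul_le x y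
    _ ≤ y' := himp_mul_le y y'

/-- Prelinearity: the join of `x ⇨ y` and `y ⇨ x` is `1`. -/
theorem prelinear (x y w : A) (h₁ : x ⇨ y ≤ w) (h₂ : y ⇨ x ≤ w) : w = 1 := by
  have key : ((x ⇨ y) ⇨ (y ⇨ x)) ⇨ (y ⇨ x) = 1 := by
    refine le_iff.1 (mul_le_iff_le_himp.1 ?_)
    calc ((x ⇨ y) ⇨ (y ⇨ x)) * y
        = ((x ⇨ y) ⇨ (y ⇨ x)) * (x ⇨ y) * ((x ⇨ y) ⇨ y) := by
          rw [mul_assoc, mul_himp_of_le (le_himp x y)]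
      _ ≤ (y ⇨ x) * ((x ⇨ y) ⇨ y) := by gcongr; exact himp_mul_le _ _
      _ = (y ⇨ x) * ((y ⇨ x) ⇨ x) := by rw [tanaka]
      _ ≤ x := mul_himp_le _ _
  refine eq_one_of_one_le ?_
  rw [← key]
  calc ((x ⇨ y) ⇨ (y ⇨ x)) ⇨ (y ⇨ x) ≤ (w ⇨ (y ⇨ x)) ⇨ (y ⇨ x) :=
        himp_le_himp_right (himp_le_himp_right h₁ _) _
    _ = w := himp_himp_of_le h₂

/-- If the join of `x` and `y` is `1`, so is the join of `x ^ n` and `y`. -/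
theorem eq_one_of_pow_le {x y : A} (h : ∀ w, x ≤ w → y ≤ w → w = 1) (n : ℕ) :
    ∀ w, x ^ n ≤ w → y ≤ w → w = 1 := by
  induction n with
  | zero => intro w hx _; exact eq_one_of_one_le (by simpa using hx)
  | succ n ih =>
    intro w hx hy
    rw [pow_succ, mul_le_iff_le_himp] at hx
    exact h w (ih _ hx (hy.trans (le_himp x w))) hy

/-! ### Implicative filters and quotients -/

/-- An implicative filter, given by its underlying set: it contains `1` and is closed under modus
ponens. -/
structure IsFilter (F : Set A) : Prop where
  one_mem : 1 ∈ F
  mp {x y : A} : x ∈ F → x ⇨ y ∈ F → y ∈ F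

namespace IsFilter

variable {F : Set A}

theorem mem_of_le (hF : IsFilter F) {x y : A} (hx : x ∈ F) (h : x ≤ y) : y ∈ F :=
  hF.mp hx (by rw [le_iff.1 h]; exact hF.one_mem)

theorem mul_mem (hF : IsFilter F) {x y : A} (hx : x ∈ F) (hy : y ∈ F) : x * y ∈ F :=
  hF.mp hy (hF.mem_of_le hx (mul_le_iff_le_himp.1 le_rfl))

/-- The filter generated by a filter `F` and an element `x`. -/
theorem adjoin (hF : IsFilter F) (x : A) : IsFilter {y | ∃ n : ℕ, x ^ n ⇨ y ∈ F} where
  one_mem := ⟨0, by simpa using hF.one_mem⟩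
  mp := by
    rintro y w ⟨n, hn⟩ ⟨m, hm⟩
    refine ⟨m + n, hF.mem_of_le (hF.mul_mem hm hn) ?_⟩
    rw [← mul_le_iff_le_himp, pow_add]
    calc (x ^ m ⇨ (y ⇨ w)) * (x ^ n ⇨ y) * (x ^ m * x ^ n)
        = ((x ^ m ⇨ (y ⇨ w)) * x ^ m) * ((x ^ n ⇨ y) * x ^ n) := by ac_rfl
      _ ≤ (y ⇨ w) * y := mul_le_mul' (himp_mul_le _ _) (himp_mul_le _ _)
      _ ≤ w := himp_mul_le _ _

end IsFilter

/-- A filter maximal among those avoiding `a` is prime, so that its quotient is a chain. -/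
theorem exists_prime_filter {a : A} (ha : a ≠ 1) :
    ∃ F : Set A, IsFilter F ∧ a ∉ F ∧ ∀ x y : A, x ⇨ y ∈ F ∨ y ⇨ x ∈ F := by
  obtain ⟨F, hF⟩ := zorn_subset {F : Set A | IsFilter F ∧ a ∉ F} (by
    intro c hc hchain
    rcases c.eq_empty_or_nonempty with rfl | ⟨G, hG⟩
    · refine ⟨{1}, ⟨⟨rfl, ?_⟩, ha⟩, by simp⟩
      rintro x y rfl h
      simpa using h
    · refine ⟨⋃₀ c, ⟨⟨⟨G, hG, (hc hG).1.one_mem⟩, ?_⟩, ?_⟩, fun s hs => Set.subset_sUnion_of_mem hs⟩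
      · rintro x y ⟨S, hS, hx⟩ ⟨T, hT, hxy⟩
        rcases hchain.total hS hT with h | h
        · exact ⟨T, hT, (hc hT).1.mp (h hx) hxy⟩
        · exact ⟨S, hS, (hc hS).1.mp hx (h hxy)⟩
      · rintro ⟨S, hS, h⟩
        exact (hc hS).2 h)
  have hfil := hF.prop.1
  have adj : ∀ x, x ∉ F → ∃ n : ℕ, x ^ n ⇨ a ∈ F := by
    intro x hx
    by_contra hn
    refine hx (hF.le_of_ge (y := {y | ∃ n : ℕ, x ^ n ⇨ y ∈ F}) ⟨hfil.adjoin x, hn⟩ ?_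
      ⟨1, by simpa [himp_self] using hfil.one_mem⟩)
    intro y hy
    exact ⟨0, by simpa using hy⟩
  refine ⟨F, hfil, hF.prop.2, fun x y => ?_⟩
  by_contra! h
  obtain ⟨n, hn⟩ := adj _ h.1
  obtain ⟨m, hm⟩ := adj _ h.2
  have hf := hfil.mul_mem hn hm
  refine hF.prop.2 (hfil.mp hf ?_)
  -- the powers of `x ⇨ y` and `y ⇨ x` lie below `f ⇨ a`, where `f ∈ F` is the product above
  have h1 := eq_one_of_pow_le (x := y ⇨ x) (fun w hw hw' =>
    eq_one_of_pow_le (prelinear x y) n w hw' hw) m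
  rw [h1 (_ ⇨ a) ?_ ?_]
  · exact hfil.one_mem
  · rw [← mul_le_iff_le_himp, mul_comm, mul_le_iff_le_himp]; exact mul_le_right _ _
  · rw [← mul_le_iff_le_himp, mul_comm, mul_le_iff_le_himp]; exact mul_le_left _ _

/-- The congruence of an implicative filter. -/
def filterSetoid {F : Set A} (hF : IsFilter F) : Setoid A where
  r x y := x ⇨ y ∈ F ∧ y ⇨ x ∈ F
  iseqv :=
    { refl := fun x => by simpa [himp_self] using hF.one_mem
      symm := fun h => ⟨h.2, h.1⟩
      trans := by
        have key : ∀ {x y w : A}, x ⇨ y ∈ F → y ⇨ w ∈ F → x ⇨ w ∈ F := fun {x y w} h h' => by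
          refine hF.mem_of_le (hF.mul_mem h' h) ?_
          rw [← mul_le_iff_le_himp, mul_assoc]
          exact (mul_le_mul_right (himp_mul_le x y) _).trans (himp_mul_le y w)
        intro x y w h h'
        exact ⟨key h.1 h'.1, key h'.2 h.2⟩ }

/-- The quotient of a Wajsberg hoop by an implicative filter. -/
def FilterQuotient {F : Set A} (hF : IsFilter F) : Type u := Quotient (filterSetoid hF)

namespace FilterQuotient

variable {F : Set A} (hF : IsFilter F)

/-- The class of an element. -/
def mk (x : A) : FilterQuotient hF := Quotient.mk (filterSetoid hF) x

theorem mk_eq_mk {x y : A} : mk hF x = mk hF y ↔ x ⇨ y ∈ F ∧ y ⇨ x ∈ F :=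
  Quotient.eq (r := filterSetoid hF)

theorem mk_surjective : Function.Surjective (mk hF) := Quotient.mk_surjective

theorem mk_eq_one {x : A} : mk hF x = mk hF 1 ↔ x ∈ F := by
  rw [mk_eq_mk, himp_one, one_himp]
  exact and_iff_right hF.one_mem

instance : Mul (FilterQuotient hF) where
  mul := Quotient.map₂ (· * ·) fun _ _ hx _ _ hy =>
    ⟨hF.mem_of_le (hF.mul_mem hx.1 hy.1) (mul_himp_le_himp_mul _ _ _ _),
      hF.mem_of_le (hF.mul_mem hx.2 hy.2) (mul_himp_le_himp_mul _ _ _ _)⟩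

instance : HImp (FilterQuotient hF) where
  himp := Quotient.map₂ (· ⇨ ·) fun _ _ hx _ _ hy =>
    ⟨hF.mem_of_le (hF.mul_mem hx.2 hy.1) (mul_himp_le_himp_himp _ _ _ _),
      hF.mem_of_le (hF.mul_mem hx.1 hy.2) (mul_himp_le_himp_himp _ _ _ _)⟩

instance : One (FilterQuotient hF) := ⟨mk hF 1⟩

theorem mk_one : mk hF 1 = 1 := rfl

theorem mk_mul (x y : A) : mk hF (x * y) = mk hF x * mk hF y := rfl

theorem mk_himp (x y : A) : mk hF (x ⇨ y) = mk hF x ⇨ mk hF y := rfl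

instance : WajsbergHoop (FilterQuotient hF) where
  mul_assoc := by
    refine (mk_surjective hF).forall₃.2 fun x y w => ?_
    simp only [← mk_mul, mul_assoc]
  one_mul := by
    refine (mk_surjective hF).forall.2 fun x => ?_
    rw [← mk_one, ← mk_mul, one_mul]
  mul_one := by
    refine (mk_surjective hF).forall.2 fun x => ?_
    rw [← mk_one, ← mk_mul, mul_one]
  mul_comm := by
    refine (mk_surjective hF).forall₂.2 fun x y => ?_
    rw [← mk_mul, mul_comm, mk_mul]
  himp_self := by
    refine (mk_surjective hF).forall.2 fun x => ?_
    rw [← mk_himp, himp_self, mk_one]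
  mul_himp_comm := by
    refine (mk_surjective hF).forall₂.2 fun x y => ?_
    simp only [← mk_mul, ← mk_himp]
    rw [mul_himp_comm]
  mul_himp := by
    refine (mk_surjective hF).forall₃.2 fun x y w => ?_
    simp only [← mk_mul, ← mk_himp]
    rw [mul_himp]
  tanaka := by
    refine (mk_surjective hF).forall₂.2 fun x y => ?_
    simp only [← mk_himp]
    rw [tanaka]

end FilterQuotient

/-! ### Bounded Wajsberg hoops as MV-algebras -/

/-- The MV-algebra sum of a Wajsberg hoop with least element `z`, in which `x ⇨ z` is the
complement of `x`. -/
def oplus (z x y : A) : A := (x ⇨ z) ⇨ y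

/-- `p`, `q`, `r` sum to `1` exactly: `p` and `q` add without truncation, and `r` is the complement
of their sum. -/
def SumOne (z p q r : A) : Prop := p * q = z ∧ r = (p ⇨ z) * (q ⇨ z)

theorem SumOne.swap {z p q r : A} (h : SumOne z p q r) : SumOne z q p r :=
  ⟨by rw [mul_comm, h.1], by rw [h.2, mul_comm]⟩

section Bounded

variable {z : A} (hz : ∀ x : A, z ≤ x)
include hz

theorem compl_compl_of_bot (x : A) : (x ⇨ z) ⇨ z = x := himp_himp_of_le (hz x)

theorem mul_eq_bot_iff {x y : A} : x * y = z ↔ x ≤ y ⇨ z := by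
  rw [← mul_le_iff_le_himp]
  exact ⟨fun h => h.le, fun h => le_antisymm h (hz _)⟩

theorem compl_compl_le_compl {x : A} (hx : x * x = z) : (x ⇨ z) ⇨ z ≤ x ⇨ z := by
  rw [compl_compl_of_bot hz]
  exact (mul_eq_bot_iff hz).1 hx

theorem mul_compl (x : A) : x * (x ⇨ z) = z := le_antisymm (mul_himp_le x z) (hz _)

theorem compl_oplus (x y : A) : oplus z x y ⇨ z = (x ⇨ z) * (y ⇨ z) := by
  conv_lhs => rw [oplus, ← compl_compl_of_bot hz y, ← mul_himp]
  exact compl_compl_of_bot hz _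

theorem oplus_comm (x y : A) : oplus z x y = oplus z y x := by
  rw [← compl_compl_of_bot hz (oplus z x y), compl_oplus hz, mul_comm, ← compl_oplus hz,
    compl_compl_of_bot hz]

/-- If the product `w * d` is not truncated, then it determines `w`. -/
theorem himp_mul_cancel {d w : A} (h : d ⇨ z ≤ w) : d ⇨ (w * d) = w := by
  conv_lhs => rw [← compl_compl_of_bot hz (w * d)]
  rw [← mul_himp d, mul_comm d, mul_himp _ d, mul_himp w d]
  exact himp_himp_of_le h

/-- For `x`, `y` at least one half, `2 * (x + y - 1) = (2 * x - 1) + (2 * y - 1)`. -/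
theorem oplus_mul_self_of_le {x y : A} (hx : x ⇨ z ≤ x) (h : x ≤ y) :
    oplus z (x * y) (x * y) = oplus z (x * x) (y * y) := by
  -- write `x = y * d`; the complement of `d` stands for the difference `y - x`
  obtain ⟨d, hd⟩ : ∃ d, d = y ⇨ x := ⟨_, rfl⟩
  have hyd : y * d = x := by rw [hd]; exact mul_himp_of_le h
  have hxd : x ≤ d := by rw [hd]; exact le_himp y x
  have hdy : d ⇨ z ≤ y := ((himp_le_himp_right hxd z).trans hx).trans h
  have hda : d ⇨ z ≤ x * y := by
    rw [← mul_himp_of_le hdy, ← mul_himp, hyd, mul_comm x]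
    exact mul_le_mul_right hx y
  have hxy : x * y = y * y * d := by rw [← hyd]; ac_rfl
  have hyy : y * y = d ⇨ (x * y) := by
    rw [hxy, himp_mul_cancel hz]
    exact hda.trans (mul_le_mul_left h y)
  have hxx : x * x = d * (x * y) := by rw [← hyd]; ac_rfl
  have had : (x * y) ⇨ z ≤ d := by
    simpa only [compl_compl_of_bot hz] using himp_le_himp_right hda z
  rw [oplus, oplus, hyy, ← mul_himp, hxx, mul_himp d, mul_comm _ d, mul_himp_of_le had]

namespace SumOne

variable {p q r : A}

theorem rotate (h : SumOne z p q r) : SumOne z p r q := by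
  have hqp : q ≤ p ⇨ z := (mul_eq_bot_iff hz).1 h.swap.1
  constructor
  · rw [h.2, ← mul_assoc, mul_compl hz]
    exact le_antisymm (mul_le_left _ _) (hz _)
  · rw [h.2, mul_himp, compl_compl_of_bot hz, mul_himp_of_le hqp]

end SumOne

end Bounded

/-! ### Binary expansions in bounded chains -/

section Chain

variable {z : A}

open Classical in
/-- The first binary digit of an element of a bounded chain: `0` if it is at most one half. -/
noncomputable def digit (z x : A) : ℝ := if x * x = z then 0 else 1

open Classical in
/-- The doubling map `x ↦ 2 * x - digit x` of a bounded chain. -/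
noncomputable def double (z x : A) : A := if x * x = z then oplus z x x else x * x

/-- The real number whose binary digits are read off the orbit under doubling. -/
noncomputable def realValue (z x : A) : ℝ :=
  ∑' k : ℕ, digit z ((double z)^[k] x) / 2 / 2 ^ k

theorem digit_nonneg (x : A) : 0 ≤ digit z x := by
  unfold digit; split_ifs <;> norm_num

theorem digit_le_one (x : A) : digit z x ≤ 1 := by
  unfold digit; split_ifs <;> norm_num

theorem digit_term_le (x : A) (k : ℕ) :
    digit z ((double z)^[k] x) / 2 / 2 ^ k ≤ 1 / 2 / 2 ^ k := by
  gcongr; exact digit_le_one _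

theorem digit_term_nonneg (x : A) (k : ℕ) : 0 ≤ digit z ((double z)^[k] x) / 2 / 2 ^ k := by
  have := digit_nonneg (z := z) ((double z)^[k] x)
  positivity

theorem summable_digits (x : A) :
    Summable fun k : ℕ => digit z ((double z)^[k] x) / 2 / 2 ^ k :=
  Summable.of_nonneg_of_le (digit_term_nonneg x) (digit_term_le x) (summable_geometric_two' 1)

theorem realValue_nonneg (x : A) : 0 ≤ realValue z x := tsum_nonneg (digit_term_nonneg x)

theorem realValue_le_one (x : A) : realValue z x ≤ 1 := by
  rw [← tsum_geometric_two' 1]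
  exact (summable_digits x).tsum_le_tsum (digit_term_le x) (summable_geometric_two' 1)

theorem realValue_eq (x : A) : realValue z x = (digit z x + realValue z (double z x)) / 2 := by
  rw [realValue, (summable_digits x).tsum_eq_zero_add, realValue, add_div, ← tsum_div_const]
  congr 1
  · simp
  · refine tsum_congr fun k => ?_
    rw [Function.iterate_succ_apply, pow_succ]
    field_simp

theorem realValue_of_mul_self_eq {x : A} (h : x * x = z) :
    realValue z x = realValue z (oplus z x x) / 2 := by
  rw [realValue_eq, digit, double, if_pos h, if_pos h, zero_add]

theorem realValue_of_mul_self_ne {x : A} (h : x * x ≠ z) :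
    realValue z x = (1 + realValue z (x * x)) / 2 := by
  rw [realValue_eq, digit, double, if_neg h, if_neg h]

theorem realValue_one (h : z ≠ 1) : realValue z (1 : A) = 1 := by
  have := realValue_of_mul_self_ne (z := z) (x := 1) (by simpa using h.symm)
  rw [one_mul] at this
  linarith

/-- A bounded error that is halved along some self-map vanishes. -/
theorem eq_zero_of_halving {ι : Type*} (f : ι → ℝ) (M : ℝ) (hM : ∀ i, |f i| ≤ M)
    (h : ∀ i, ∃ j, |f i| ≤ |f j| / 2) (i : ι) : f i = 0 := by
  have hb : BddAbove (Set.range fun i => |f i|) := ⟨M, by rintro _ ⟨i, rfl⟩; exact hM i⟩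
  have : Nonempty ι := ⟨i⟩
  have hs : (⨆ i, |f i|) ≤ (⨆ i, |f i|) / 2 := by
    refine ciSup_le fun i => ?_
    obtain ⟨j, hj⟩ := h i
    have := le_ciSup hb j
    linarith
  have hi := le_ciSup hb i
  exact abs_nonpos_iff.1 (by linarith)

variable (hz : ∀ x : A, z ≤ x) (hchain : ∀ x y : A, x ≤ y ∨ y ≤ x)
include hz hchain

theorem compl_le_of_mul_self_ne {x : A} (h : x * x ≠ z) : x ⇨ z ≤ x :=
  (hchain _ _).resolve_right fun h' => h ((mul_eq_bot_iff hz).2 h')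

theorem compl_mul_compl_of_mul_self_ne {x : A} (h : x * x ≠ z) : (x ⇨ z) * (x ⇨ z) = z := by
  rw [mul_eq_bot_iff hz, compl_compl_of_bot hz]
  exact compl_le_of_mul_self_ne hz hchain h

theorem oplus_mul_self {x y : A} (hx : x ⇨ z ≤ x) (hy : y ⇨ z ≤ y) :
    oplus z (x * y) (x * y) = oplus z (x * x) (y * y) := by
  rcases hchain x y with h | h
  · exact oplus_mul_self_of_le hz hx h
  · rw [mul_comm x y, oplus_comm hz (x * x)]
    exact oplus_mul_self_of_le hz hy h

theorem realValue_compl (hz1 : z ≠ 1) (x : A) : realValue z (x ⇨ z) + realValue z x - 1 = 0 := by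
  refine eq_zero_of_halving (fun x : A => realValue z (x ⇨ z) + realValue z x - 1) 1 ?_ ?_ x
  · intro x
    have h1 := realValue_nonneg (z := z) x
    have h2 := realValue_nonneg (z := z) (x ⇨ z)
    have h3 := realValue_le_one (z := z) x
    have h4 := realValue_le_one (z := z) (x ⇨ z)
    rw [abs_le]
    constructor <;> linarith
  -- doubling commutes with complements away from one half
  have key : ∀ x : A, x * x ≠ z → realValue z (x ⇨ z) + realValue z x - 1 =
      (realValue z ((x * x) ⇨ z) + realValue z (x * x) - 1) / 2 := by
    intro x h
    rw [realValue_of_mul_self_ne h,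
      realValue_of_mul_self_eq (compl_mul_compl_of_mul_self_ne hz hchain h), oplus,
      compl_compl_of_bot hz, ← mul_himp]
    ring
  intro x
  by_cases h : x * x = z
  · by_cases h' : (x ⇨ z) * (x ⇨ z) = z
    · -- both squares vanish only at `x = 1 / 2`
      have hx : x ⇨ z = x := le_antisymm
        (by simpa only [compl_compl_of_bot hz] using (mul_eq_bot_iff hz).1 h')
        ((mul_eq_bot_iff hz).1 h)
      refine ⟨x, ?_⟩
      have : realValue z x = 1 / 2 := by
        rw [realValue_of_mul_self_eq h, oplus, hx, himp_self, realValue_one hz1]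
      rw [hx, this]
      norm_num
    · refine ⟨(x ⇨ z) * (x ⇨ z), ?_⟩
      have := key _ h'
      rw [compl_compl_of_bot hz, add_comm (realValue z x)] at this
      rw [this, abs_div, abs_two]
  · exact ⟨x * x, by rw [key x h, abs_div, abs_two]⟩

namespace SumOne

variable {p q r : A}

theorem left_mul_self (h : SumOne z p q r) (hr : r * r ≠ z) : p * p = z := by
  refine (mul_eq_bot_iff hz).2 ?_
  have hrp : r ≤ p ⇨ z := h.2 ▸ mul_le_left _ _
  calc p = (p ⇨ z) ⇨ z := (compl_compl_of_bot hz p).symm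
    _ ≤ r ⇨ z := himp_le_himp_right hrp z
    _ ≤ r := compl_le_of_mul_self_ne hz hchain hr
    _ ≤ p ⇨ z := hrp

/-- Doubling a sum equal to `1`, when no summand exceeds one half: the complements of the doubled
summands sum to `1`. -/
theorem double_of_small (h : SumOne z p q r) (hp : p * p = z) (hq : q * q = z) (hr : r * r = z) :
    SumOne z (oplus z p p ⇨ z) (oplus z q q ⇨ z) (oplus z r r ⇨ z) := by
  rw [compl_oplus hz, compl_oplus hz]
  constructor
  · rw [mul_mul_mul_comm, ← h.2, hr]
  · rw [h.2, oplus_mul_self hz hchain (compl_compl_le_compl hz hp) (compl_compl_le_compl hz hq),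
      compl_oplus hz]

/-- Doubling a sum equal to `1`, when `r` exceeds one half. -/
theorem double_of_large (h : SumOne z p q r) (hr : r * r ≠ z) :
    SumOne z (oplus z p p) (oplus z q q) (r * r) := by
  have hp := h.left_mul_self hz hchain hr
  have hq := h.swap.left_mul_self hz hchain hr
  constructor
  · have : oplus z r r = oplus z ((p ⇨ z) * (p ⇨ z)) ((q ⇨ z) * (q ⇨ z)) := by
      rw [h.2, oplus_mul_self hz hchain (compl_compl_le_compl hz hp) (compl_compl_le_compl hz hq)]
    rw [← compl_compl_of_bot hz (oplus z p p), ← compl_compl_of_bot hz (oplus z q q),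
      compl_oplus hz, compl_oplus hz, ← compl_oplus hz (_ * _), ← this, compl_oplus hz]
    exact compl_mul_compl_of_mul_self_ne hz hchain hr
  · rw [compl_oplus hz, compl_oplus hz, mul_mul_mul_comm, ← h.2]

theorem realValue_add (hz1 : z ≠ 1) (h : SumOne z p q r) :
    realValue z p + realValue z q + realValue z r = 1 := by
  suffices realValue z p + realValue z q + realValue z r - 1 = 0 by linarith
  refine eq_zero_of_halving
    (fun t : {t : A × A × A // SumOne z t.1 t.2.1 t.2.2} =>
      realValue z t.1.1 + realValue z t.1.2.1 + realValue z t.1.2.2 - 1) 2 ?_ ?_ ⟨(p, q, r), h⟩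
  · rintro ⟨⟨p, q, r⟩, -⟩
    have h1 := realValue_nonneg (z := z) p
    have h2 := realValue_nonneg (z := z) q
    have h3 := realValue_nonneg (z := z) r
    have h4 := realValue_le_one (z := z) p
    have h5 := realValue_le_one (z := z) q
    have h6 := realValue_le_one (z := z) r
    rw [abs_le]
    constructor <;> dsimp only <;> linarith
  have key : ∀ p q r : A, SumOne z p q r → r * r ≠ z →
      ∃ p' q' r' : A, SumOne z p' q' r' ∧
        |realValue z p + realValue z q + realValue z r - 1| ≤
          |realValue z p' + realValue z q' + realValue z r' - 1| / 2 := by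
    intro p q r h hr
    refine ⟨_, _, _, h.double_of_large hz hchain hr, le_of_eq ?_⟩
    rw [realValue_of_mul_self_eq (h.left_mul_self hz hchain hr),
      realValue_of_mul_self_eq (h.swap.left_mul_self hz hchain hr), realValue_of_mul_self_ne hr,
      ← abs_two, ← abs_div, abs_two]
    congr 1
    ring
  rintro ⟨⟨p, q, r⟩, h⟩
  suffices ∃ p' q' r' : A, SumOne z p' q' r' ∧
      |realValue z p + realValue z q + realValue z r - 1| ≤
        |realValue z p' + realValue z q' + realValue z r' - 1| / 2 by
    obtain ⟨p', q', r', h', hle⟩ := this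
    exact ⟨⟨(p', q', r'), h'⟩, hle⟩
  by_cases hr : r * r = z
  · by_cases hq : q * q = z
    · by_cases hp : p * p = z
      · refine ⟨_, _, _, h.double_of_small hz hchain hp hq hr, le_of_eq ?_⟩
        have h1 := realValue_compl hz hchain hz1 (oplus z p p)
        have h2 := realValue_compl hz hchain hz1 (oplus z q q)
        have h3 := realValue_compl hz hchain hz1 (oplus z r r)
        rw [realValue_of_mul_self_eq hp, realValue_of_mul_self_eq hq, realValue_of_mul_self_eq hr,
          ← abs_two, ← abs_div, abs_two, ← abs_neg]
        congr 1
        linarith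
      · have := key _ _ _ (h.swap.rotate hz) hp
        rwa [show realValue z q + realValue z r + realValue z p =
          realValue z p + realValue z q + realValue z r by ring] at this
    · have := key _ _ _ (h.rotate hz) hq
      rwa [add_right_comm] at this
  · exact key p q r h hr

end SumOne

/-- On `y ≤ x`, implication is the untruncated sum of `y` and the complement of `x`. -/
theorem realValue_himp_of_le (hz1 : z ≠ 1) {x y : A} (h : y ≤ x) :
    realValue z (x ⇨ y) = 1 - realValue z x + realValue z y := by
  have hs : SumOne z (x ⇨ z) y (oplus z (x ⇨ z) y ⇨ z) := by
    refine ⟨?_, compl_oplus hz _ _⟩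
    rw [mul_comm, mul_eq_bot_iff hz, compl_compl_of_bot hz]
    exact h
  have h1 := hs.realValue_add hz hchain hz1
  have h2 := realValue_compl hz hchain hz1 (oplus z (x ⇨ z) y)
  have h3 := realValue_compl hz hchain hz1 x
  rw [oplus, compl_compl_of_bot hz] at h1 h2
  linarith

theorem realValue_himp (hz1 : z ≠ 1) (x y : A) :
    realValue z (x ⇨ y) = min 1 (1 - realValue z x + realValue z y) := by
  rcases hchain y x with h | h
  · rw [← realValue_himp_of_le hz hchain hz1 h, min_eq_right (realValue_le_one _)]
  · have h1 := realValue_himp_of_le hz hchain hz1 h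
    have h2 := realValue_le_one (z := z) (y ⇨ x)
    rw [le_iff.1 h, realValue_one hz1, min_eq_left (by linarith)]

theorem realValue_mul (hz1 : z ≠ 1) (x y : A) :
    realValue z (x * y) = max 0 (realValue z x + realValue z y - 1) := by
  have h1 := realValue_himp hz hchain hz1 x (y ⇨ z)
  have h2 := realValue_compl hz hchain hz1 (x * y)
  have h3 := realValue_compl hz hchain hz1 y
  rw [mul_himp, h1] at h2
  grind

theorem realValue_bot (hz1 : z ≠ 1) : realValue z z = 0 := by
  have := realValue_compl hz hchain hz1 z
  rw [himp_self, realValue_one hz1] at this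
  linarith

end Chain

/-! ### The standard Wajsberg hoop on the unit interval -/

end Order

/-- The unit interval, as a type of its own: Mathlib's `unitInterval` already carries the
multiplication of the reals. -/
def Standard : Type := Set.Icc (0 : ℝ) 1

namespace Standard

/-- The underlying real number. -/
def val (x : Standard) : ℝ := Subtype.val x

theorem val_nonneg (x : Standard) : 0 ≤ x.val := x.2.1

theorem val_le_one (x : Standard) : x.val ≤ 1 := x.2.2

@[ext]
theorem ext {x y : Standard} (h : x.val = y.val) : x = y := Subtype.ext h

noncomputable instance : Mul Standard where
  mul x y := ⟨max 0 (x.val + y.val - 1), le_max_left _ _, max_le zero_le_one (by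
    have := x.val_le_one; have := y.val_le_one; linarith)⟩

instance : One Standard := ⟨⟨1, zero_le_one, le_rfl⟩⟩

noncomputable instance : HImp Standard where
  himp x y := ⟨min 1 (1 - x.val + y.val), le_min zero_le_one (by
    have := x.val_le_one; have := y.val_nonneg; linarith), min_le_left _ _⟩

theorem val_mul (x y : Standard) : (x * y).val = max 0 (x.val + y.val - 1) := rfl

theorem val_one : (1 : Standard).val = 1 := rfl

theorem val_himp (x y : Standard) : (x ⇨ y).val = min 1 (1 - x.val + y.val) := rfl

/-- The Łukasiewicz operations make the unit interval a Wajsberg hoop. -/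
noncomputable instance : WajsbergHoop Standard where
  mul_assoc x y w := by
    have := x.val_le_one; have := w.val_le_one
    ext; simp only [val_mul]; grind
  one_mul x := by
    have := x.val_nonneg
    ext; simp only [val_mul, val_one]; grind
  mul_one x := by
    have := x.val_nonneg
    ext; simp only [val_mul, val_one]; grind
  mul_comm x y := by
    ext; simp only [val_mul]; grind
  himp_self x := by
    ext; simp only [val_himp, val_one]; grind
  mul_himp_comm x y := by
    have := x.val_nonneg; have := y.val_nonneg
    have := x.val_le_one; have := y.val_le_one
    ext; simp only [val_mul, val_himp]; grind
  mul_himp x y w := by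
    have := x.val_le_one; have := y.val_le_one; have := w.val_nonneg
    ext; simp only [val_mul, val_himp]; grind
  tanaka x y := by
    have := x.val_le_one; have := y.val_le_one
    ext; simp only [val_himp]; grind

end Standard

/-! ### Homomorphisms to the unit interval -/

/-- A homomorphism from a Wajsberg hoop to the standard one. (`Hom` needs both hoops to live in the
same universe.) -/
structure StandardHom (A : Type u) [WajsbergHoop A] where
  toFun : A → Standard
  map_one : toFun 1 = 1
  map_mul (x y : A) : toFun (x * y) = toFun x * toFun y
  map_himp (x y : A) : toFun (x ⇨ y) = toFun x ⇨ toFun y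

section

attribute [local instance] naturalOrder

variable {A : Type u} [WajsbergHoop A]

/-- In a bounded hoop, idempotents other than `1` are separated from `1` by homomorphisms to the
unit interval. -/
theorem exists_standardHom_ne_one {z a : A} (hz : ∀ x : A, z ⇨ x = 1) (ha : a * a = a)
    (ha1 : a ≠ 1) : ∃ φ : StandardHom A, φ.toFun a ≠ 1 := by
  obtain ⟨F, hF, haF, hprime⟩ := exists_prime_filter ha1
  let q := FilterQuotient.mk hF
  have hq : Function.Surjective q := FilterQuotient.mk_surjective hF
  have hbot : ∀ x, q z ≤ x := hq.forall.2 fun x => by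
    rw [le_iff, ← FilterQuotient.mk_himp, hz]; rfl
  have hchain : ∀ x y : FilterQuotient hF, x ≤ y ∨ y ≤ x := hq.forall₂.2 fun x y =>
    (hprime x y).imp (FilterQuotient.mk_eq_one hF).2 (FilterQuotient.mk_eq_one hF).2
  have hqa1 : q a ≠ 1 := fun h => haF ((FilterQuotient.mk_eq_one hF).1 h)
  have hz1 : q z ≠ 1 := fun h => hqa1 (eq_one_of_one_le (h ▸ hbot (q a)))
  -- an idempotent has join `1` with its complement, so in a chain it is trivial
  have hqa : q a = q z := by
    have han : a ⇨ (a ⇨ z) = a ⇨ z := by rw [← mul_himp, ha]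
    rcases hprime a (a ⇨ z) with h | h
    · rw [han] at h
      exact (FilterQuotient.mk_eq_mk hF).2 ⟨h, by rw [hz]; exact hF.one_mem⟩
    · have : ((a ⇨ z) ⇨ a) ⇨ a = 1 := by rw [tanaka, han, himp_self]
      exact absurd (hF.mem_of_le h this) haF
  refine ⟨⟨fun x => ⟨realValue (q z) (q x), realValue_nonneg _, realValue_le_one _⟩, ?_, ?_, ?_⟩, ?_⟩
  · exact Standard.ext (realValue_one hz1)
  · exact fun x y => Standard.ext (realValue_mul hbot hchain hz1 (q x) (q y))
  · exact fun x y => Standard.ext (realValue_himp hbot hchain hz1 (q x) (q y))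
  · intro h
    have h1 : realValue (q z) (q a) = 1 := congrArg Standard.val h
    rw [hqa, realValue_bot hbot hchain hz1] at h1
    exact zero_ne_one h1

end

/-! ### The hoop of paths -/

instance {ι : Type*} {X : ι → Type*} [∀ i, WajsbergHoop (X i)] : WajsbergHoop (∀ i, X i) where
  himp_self x := funext fun i => himp_self (x i)
  mul_himp_comm x y := funext fun i => mul_himp_comm (x i) (y i)
  mul_himp x y w := funext fun i => mul_himp (x i) (y i) (w i)
  tanaka x y := funext fun i => tanaka (x i) (y i)

instance {X Y : Type*} [WajsbergHoop X] [WajsbergHoop Y] : WajsbergHoop (X × Y) where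
  himp_self x := Prod.ext (himp_self x.1) (himp_self x.2)
  mul_himp_comm x y := Prod.ext (mul_himp_comm x.1 y.1) (mul_himp_comm x.2 y.2)
  mul_himp x y w := Prod.ext (mul_himp x.1 y.1 w.1) (mul_himp x.2 y.2 w.2)
  tanaka x y := Prod.ext (tanaka x.1 y.1) (tanaka x.2 y.2)

/-- Elements `a` of `A` together with, for each homomorphism `φ` from `A` to the unit interval, a
continuous path in the unit interval from `φ a` to `1`. -/
def pathHoop (A : Type u) [WajsbergHoop A] :
    Subhoop (A × (StandardHom A → unitInterval → Standard)) where
  carrier := {x | ∀ φ, (Continuous fun t => (x.2 φ t).val) ∧ x.2 φ 0 = φ.toFun x.1 ∧ x.2 φ 1 = 1}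
  one_mem φ := ⟨continuous_const, φ.map_one.symm, rfl⟩
  mul_mem {x y} hx hy φ := by
    refine ⟨?_, ?_, ?_⟩
    · exact continuous_const.max (((hx φ).1.add (hy φ).1).sub continuous_const)
    · exact (congrArg₂ (· * ·) (hx φ).2.1 (hy φ).2.1).trans (φ.map_mul _ _).symm
    · exact (congrArg₂ (· * ·) (hx φ).2.2 (hy φ).2.2).trans (mul_one 1)
  himp_mem {x y} hx hy φ := by
    refine ⟨?_, ?_, ?_⟩
    · exact continuous_const.min ((continuous_const.sub (hx φ).1).add (hy φ).1)
    · exact (congrArg₂ (· ⇨ ·) (hx φ).2.1 (hy φ).2.1).trans (φ.map_himp _ _).symm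
    · exact (congrArg₂ (· ⇨ ·) (hx φ).2.2 (hy φ).2.2).trans (himp_self 1)

/-- The projection of the hoop of paths to `A`. -/
def pathProj (A : Type u) [WajsbergHoop A] : Hom (pathHoop A).Elem A where
  toFun x := x.1.1
  map_one := rfl
  map_mul _ _ := rfl
  map_himp _ _ := rfl

theorem pathProj_surjective (A : Type u) [WajsbergHoop A] : Function.Surjective (pathProj A) := by
  intro a
  refine ⟨⟨(a, fun φ t => ⟨max (φ.toFun a).val t, le_max_of_le_right t.2.1,
    max_le (φ.toFun a).val_le_one t.2.2⟩), fun φ => ⟨?_, ?_, ?_⟩⟩, rfl⟩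
  · exact continuous_const.max continuous_subtype_val
  · exact Standard.ext (max_eq_left (φ.toFun a).val_nonneg)
  · exact Standard.ext (max_eq_right (φ.toFun a).val_le_one)

/-- A path of idempotents of the unit interval is constant, the interval being connected and its
only idempotents being `0` and `1`. -/
theorem eq_one_of_idempotent_path {p : unitInterval → Standard}
    (hp : Continuous fun t => (p t).val) (h1 : p 1 = 1) (hidem : ∀ t, p t * p t = p t) :
    p = 1 := by
  have hval : ∀ t, (p t).val = 0 ∨ (p t).val = 1 := fun t => by
    have := congrArg Standard.val (hidem t)
    rw [Standard.val_mul] at this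
    grind
  funext s
  refine (hval s).elim (fun h0 => ?_) (fun h => Standard.ext h)
  obtain ⟨t, ht⟩ := intermediate_value_univ s 1 hp
    (show (1 / 2 : ℝ) ∈ Set.Icc (p s).val (p 1).val by
      rw [h0, h1, Standard.val_one]; constructor <;> norm_num)
  dsimp only at ht
  rcases hval t with h | h <;> rw [h] at ht <;> norm_num at ht

/-- If `A` is bounded, then the hoop of paths has no idempotent other than `1`. -/
theorem pathHoop_idempotent_eq_one {A : Type u} [WajsbergHoop A] (hA : Bounded A)
    {x : (pathHoop A).Elem} (hx : x * x = x) : x = 1 := by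
  obtain ⟨z, hz⟩ := hA
  have hx' : x.1 * x.1 = x.1 := congrArg Subtype.val hx
  have hidem : ∀ φ t, x.1.2 φ t * x.1.2 φ t = x.1.2 φ t := fun φ t =>
    congrFun (congrFun (congrArg Prod.snd hx') φ) t
  have hpath : ∀ φ, x.1.2 φ = 1 := fun φ =>
    eq_one_of_idempotent_path (x.2 φ).1 (x.2 φ).2.2 (hidem φ)
  have hfst : x.1.1 = 1 := by
    by_contra hne
    obtain ⟨φ, hφ⟩ := exists_standardHom_ne_one hz (congrArg Prod.fst hx') hne
    exact hφ ((x.2 φ).2.1.symm.trans (congrFun (hpath φ) 0))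
  exact Subtype.ext (Prod.ext hfst (funext hpath))

/-- A least element is idempotent. -/
theorem mul_self_of_least {A : Type u} [WajsbergHoop A] {b : A} (hb : ∀ x : A, b ⇨ x = 1) :
    b * b = b :=
  (naturalOrder A).le_antisymm _ _ (mul_le_left b b) (hb _)

theorem not_injective_hom_pathHoop {A : Type u} [WajsbergHoop A] [Nontrivial A] (hA : Bounded A)
    (e : Hom A (pathHoop A).Elem) : ¬ Function.Injective e := by
  intro he
  obtain ⟨b, hb⟩ := hA
  have hb1 : b = 1 := he <| by
    rw [e.map_one]
    exact pathHoop_idempotent_eq_one ⟨b, hb⟩ (by rw [← e.map_mul, mul_self_of_least hb])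
  obtain ⟨x, hx⟩ := exists_ne (1 : A)
  have h := hb x
  rw [hb1, one_himp] at h
  exact hx h

theorem WeaklyProjective.unbounded {A : Type u} [WajsbergHoop A] [Nontrivial A]
    (h : WeaklyProjective A) : Unbounded A := by
  intro hA
  obtain ⟨S, f, hf⟩ := h (pathHoop A).Elem ⟨pathProj A, pathProj_surjective A⟩
  exact not_injective_hom_pathHoop hA
    ⟨fun a => (f a).1, congrArg Subtype.val f.map_one,
      fun x y => congrArg Subtype.val (f.map_mul x y),
      fun x y => congrArg Subtype.val (f.map_himp x y)⟩
    (Subtype.val_injective.comp hf.1)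

theorem Projective.unbounded {A : Type u} [WajsbergHoop A] [Nontrivial A]
    (h : Projective A) : Unbounded A := by
  intro hA
  obtain ⟨e, he⟩ := h _ A (pathProj A) ⟨id, rfl, fun _ _ => rfl, fun _ _ => rfl⟩
    (pathProj_surjective A)
  exact not_injective_hom_pathHoop hA e (Function.LeftInverse.injective he)

end WajsbergHoop

theorem MVAlgebra.bounded_zeroFreeReduct (M : Type u) [MVAlgebra M] :
    WajsbergHoop.Bounded (MVAlgebra.ZeroFreeReduct M) := by
  refine ⟨(0 : M), fun x => ?_⟩
  change (0 : M)ᶜ + (show M from x) = (0 : M)ᶜ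
  rw [add_comm]
  exact MVAlgebra.add_compl_zero _

theorem mainTheorem11 :
    (∀ (A : Type u) [WajsbergHoop A] [Nontrivial A],
      WajsbergHoop.FinitelyGenerated A → WajsbergHoop.WeaklyProjective A →
        WajsbergHoop.Unbounded A) ∧
    (∀ (A : Type u) [WajsbergHoop A] [Nontrivial A],
      WajsbergHoop.FinitelyGenerated A → WajsbergHoop.Projective A →
        WajsbergHoop.Unbounded A) ∧
    (∀ (M : Type u) [MVAlgebra M] [Nontrivial M],
      WajsbergHoop.FinitelyGenerated (MVAlgebra.ZeroFreeReduct M) →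
        ¬ WajsbergHoop.Projective (MVAlgebra.ZeroFreeReduct M)) := by
  refine ⟨fun A _ _ _ h => h.unbounded, fun A _ _ _ h => h.unbounded, fun M _ hM _ h => ?_⟩
  have : Nontrivial (MVAlgebra.ZeroFreeReduct M) := hM
  exact h.unbounded (MVAlgebra.bounded_zeroFreeReduct M)
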